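/- For a finite group $G$, let $\sigma(G)$ denote the least number of proper subgroups of $G$ whose set-theoretical union is equal to $G$, with $\sigma(G)=\infty$ if no such family of subgroups exists (that is, if $G$ is cyclic). Let $AGL(4,2)=\mathbb{F}_2^4\rtimes GL(4,2)$ be the affine general linear group of degree $4$ over the field $\mathbb{F}_2$ with two elements, where $GL(4,2)$ acts on $\mathbb{F}_2^4$ in the natural way. Then $$\sigma(AGL(4,2))\geq 31.$$ -/

import Mathlib

open scoped MatrixGroups

/-- A cover of a group `G`: a family of proper subgroups whose set-theoretical union is `G`. -/
def IsSubgroupCover {G : Type*} [Group G] (C : Set (Subgroup G)) : Prop :=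
  (∀ H ∈ C, H ≠ ⊤) ∧ (⋃ H ∈ C, (H : Set G)) = Set.univ

/-- The sum `σ(G)` of a finite group `G`: the least cardinality of a cover of `G`.
The infimum in `ℕ∞` over the empty family is `⊤`, so `σ(G) = ∞` when `G` has no cover,
that is, when `G` is cyclic. -/
noncomputable def groupSum (G : Type*) [Group G] : ℕ∞ :=
  ⨅ C ∈ {C : Set (Subgroup G) | IsSubgroupCover C}, C.encard

/-- The natural action of `GL(n, K)` on the (multiplicatively written) additive group `K ^ n`
of column vectors, `g • v = g v`. -/
def glVecAction (n : ℕ) (K : Type*) [Field K] :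
    GL (Fin n) K →* MulAut (Multiplicative (Fin n → K)) where
  toFun g :=
    { toFun := fun v => Multiplicative.ofAdd ((g : Matrix (Fin n) (Fin n) K).mulVec v.toAdd)
      invFun := fun v =>
        Multiplicative.ofAdd (((g⁻¹ : GL (Fin n) K) : Matrix (Fin n) (Fin n) K).mulVec v.toAdd)
      left_inv := fun v => by
        beta_reduce
        rw [toAdd_ofAdd, Matrix.mulVec_mulVec, ← Units.val_mul, inv_mul_cancel, Units.val_one,
          Matrix.one_mulVec, ofAdd_toAdd]
      right_inv := fun v => by
        beta_reduce
        rw [toAdd_ofAdd, Matrix.mulVec_mulVec, ← Units.val_mul, mul_inv_cancel, Units.val_one,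
          Matrix.one_mulVec, ofAdd_toAdd]
      map_mul' := fun v w => by rw [toAdd_mul, Matrix.mulVec_add, ofAdd_add] }
  map_one' := by
    ext v : 1
    change Multiplicative.ofAdd ((1 : Matrix (Fin n) (Fin n) K).mulVec v.toAdd) = v
    rw [Matrix.one_mulVec, ofAdd_toAdd]
  map_mul' g h := by
    ext v : 1
    change Multiplicative.ofAdd (((g : Matrix (Fin n) (Fin n) K) * h).mulVec v.toAdd) =
      Multiplicative.ofAdd ((g : Matrix (Fin n) (Fin n) K).mulVec
        ((h : Matrix (Fin n) (Fin n) K).mulVec v.toAdd))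
    rw [Matrix.mulVec_mulVec]

/-- The affine general linear group of degree `n` over `K`, as the semidirect product
`K ^ n ⋊ GL(n, K)` for the natural action. -/
abbrev AGL (n : ℕ) (K : Type*) [Field K] : Type _ :=
  Multiplicative (Fin n → K) ⋊[glVecAction n K] GL (Fin n) K

/-!
The idea is to exhibit `31` elements of `AGL(4, 2)` any two of which generate the whole group. A
proper subgroup contains at most one of them, so a cover needs at least `31` members
(`card_le_groupSum`).

The elements are found by looking at the maximal subgroups. Let `y` be a Singer cycle, that is, an
element of order `15` of `GL(4, 2)`, acting on `𝔽₂⁴ ≅ 𝔽₁₆` as multiplication by a primitive element.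
Besides `y` take the conjugates `y ^ i * x * y ^ (-i)` and `y ^ i * z * y ^ (-i)` for `i < 15`, where

* `x` (below `singer'`) has order `15` and fixes a nonzero vector, so that `y` and the conjugates of
  `x` are distributed over the `16` point stabilizers. Identify `GL(4, 2)` with the alternating
  group of degree `8`: an element of order `15` is the product of a `5`-cycle and a disjoint
  `3`-cycle, and the only maximal subgroup containing it is the stabilizer of the support of the
  `3`-cycle. The linear part of `x` is chosen such that these supports differ for the `16` elements;
* `z` (below `fpf`) has no fixed points, and its linear part has order `6` and fixes exactly one
  nonzero vector. So `z` lies in no point stabilizer, and more generally in no complement of the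
  translation subgroup, since `z ^ 6` is a nontrivial translation. The linear part of `z`, a product
  of a `6`-cycle and a `2`-cycle, lies in no proper subgroup of `GL(4, 2)` together with an element
  of order `15`, and it is chosen such that it generates `GL(4, 2)` with any of its conjugates by
  powers of `y`.

Conjugating by powers of `y` reduces the pairs to those that contain `y`, `x` or `z`
(`closure_pair_conj_eq_top`), and for these generation is established by expressing known
generators as short words. That `y` and `z` generate (`closure_singer_fpf_eq_top`) follows since the
`y`-conjugates of `z ^ 6` are all the nontrivial translations, and the elementary transvections,
which generate `GL(4, 2)`, are words in `y` and `z`. Words are evaluated on labels of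
the `16` vectors, the vector `α ^ k` being labelled by its discrete logarithm `k`; this determines
the word since the action on `𝔽₂⁴` is faithful.
-/

open Subgroup

/-! ### Pairwise generating families and covers -/

/-- A proper subgroup contains at most one member of a pairwise generating family, so the
members of the family lie in distinct members of any cover. -/
theorem card_le_groupSum {G ι : Type*} [Group G] [Fintype ι] (a : ι → G)
    (ha : Pairwise fun i j => closure {a i, a j} = ⊤) :
    (Fintype.card ι : ℕ∞) ≤ groupSum G := by
  refine le_iInf₂ fun C hC => ?_
  obtain ⟨hproper, hcover⟩ := hC
  have hmem : ∀ i, ∃ H ∈ C, a i ∈ H := fun i => by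
    have : a i ∈ ⋃ H ∈ C, (H : Set G) := hcover ▸ Set.mem_univ _
    simpa using this
  choose H hHC haH using hmem
  have hinj : Function.Injective H := by
    intro i j hij
    by_contra hne
    refine hproper _ (hHC i) (top_le_iff.mp ?_)
    rw [← ha hne, closure_le]
    rintro _ (rfl | rfl)
    · exact haH i
    · rw [hij]
      exact haH j
  calc (Fintype.card ι : ℕ∞) = (Set.range H).encard := by
        rw [← Set.image_univ, hinj.encard_image, Set.encard_univ, ENat.card_eq_coe_fintype_card]
    _ ≤ C.encard := Set.encard_le_encard (Set.range_subset_iff.mpr hHC)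

section Group

variable {G : Type*} [Group G]

/-- The product of the elements `a ^ m * b ^ n` for the pairs `(m, n)` of a list. -/
def pairWord (a b : G) (w : List (ℕ × ℕ)) : G :=
  (w.map fun p => a ^ p.1 * b ^ p.2).prod

theorem pairWord_mem {K : Subgroup G} {a b : G} (ha : a ∈ K) (hb : b ∈ K) (w : List (ℕ × ℕ)) :
    pairWord a b w ∈ K := by
  refine K.list_prod_mem fun c hc => ?_
  obtain ⟨p, -, rfl⟩ := List.mem_map.mp hc
  exact mul_mem (pow_mem ha _) (pow_mem hb _)

theorem closure_pair_eq_top_of_mem {a b c d : G} (h : closure {a, b} = ⊤)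
    (ha : a ∈ closure {c, d}) (hb : b ∈ closure {c, d}) : closure {c, d} = ⊤ := by
  rw [eq_top_iff, ← h, closure_le]
  rintro _ (rfl | rfl) <;> assumption

theorem left_mem_closure_pair (a b : G) : a ∈ closure {a, b} := subset_closure (by simp)

theorem right_mem_closure_pair (a b : G) : b ∈ closure {a, b} := subset_closure (by simp)

theorem closure_pair_conj (g a b : G) (h : closure {a, b} = ⊤) :
    closure {g * a * g⁻¹, g * b * g⁻¹} = ⊤ := by
  have := congrArg (Subgroup.map (MulAut.conj g).toMonoidHom) h
  rwa [MonoidHom.map_closure, Set.image_pair,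
    map_top_of_surjective _ (MulAut.conj g).surjective] at this

/-- Conjugating a pair of conjugates by a power of `y` moves the first conjugate to `a`. -/
theorem closure_pair_conj_eq_top {n : ℕ} [NeZero n] {y : G} (hy : y ^ n = 1) {a b : G} {i j : Fin n}
    (h : closure {a, y ^ (j - i).val * b * (y ^ (j - i).val)⁻¹} = ⊤) :
    closure {y ^ i.val * a * (y ^ i.val)⁻¹, y ^ j.val * b * (y ^ j.val)⁻¹} = ⊤ := by
  have hj : y ^ j.val = y ^ i.val * y ^ (j - i).val := by
    rw [← pow_add, pow_eq_pow_mod (_ + _) hy, ← Fin.val_add, add_sub_cancel]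
  have := closure_pair_conj (y ^ i.val) _ _ h
  rw [hj, mul_inv_rev]
  simpa only [mul_assoc] using this

end Group

/-! ### The action on vectors -/

section Action

variable {n : ℕ} {K : Type*} [Field K]

/-- The natural action of `AGL(n, K)` on `K ^ n`, by `v ↦ g v + t`. -/
def affineAct (a : AGL n K) (v : Fin n → K) : Fin n → K :=
  (a.right : Matrix (Fin n) (Fin n) K).mulVec v + a.left.toAdd

theorem affineAct_one (v : Fin n → K) : affineAct 1 v = v := by
  simp [affineAct]

theorem affineAct_mul (a b : AGL n K) (v : Fin n → K) :
    affineAct (a * b) v = affineAct a (affineAct b v) := by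
  simp only [affineAct, SemidirectProduct.mul_left, SemidirectProduct.mul_right, Units.val_mul,
    Matrix.mulVec_add, Matrix.mulVec_mulVec, toAdd_mul]
  rw [add_comm a.left.toAdd, ← add_assoc]
  rfl

/-- The action of `AGL(n, K)` on `K ^ n` is faithful. -/
theorem affineAct_injective {a b : AGL n K} (h : ∀ v, affineAct a v = affineAct b v) : a = b := by
  have hleft : a.left = b.left := by
    simpa [affineAct] using h 0
  have hright : a.right = b.right := by
    refine Units.ext (Matrix.mulVec_injective (funext fun v => ?_))
    simpa [affineAct, hleft] using h v
  exact SemidirectProduct.ext hleft hright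

end Action

/-- Labels of the `16` vectors of `𝔽₂⁴`. For a root `α` of `X⁴ + X + 1`, label `k < 15` stands for
the coordinate vector of `α ^ k` in the basis `1, α, α², α³` of `𝔽₁₆`, and label `15` for `0`. -/
def labelVec : Fin 16 → Fin 4 → ZMod 2 :=
  ![![1, 0, 0, 0], ![0, 1, 0, 0], ![0, 0, 1, 0], ![0, 0, 0, 1],
    ![1, 1, 0, 0], ![0, 1, 1, 0], ![0, 0, 1, 1], ![1, 1, 0, 1],
    ![1, 0, 1, 0], ![0, 1, 0, 1], ![1, 1, 1, 0], ![0, 1, 1, 1],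
    ![1, 1, 1, 1], ![1, 0, 1, 1], ![1, 0, 0, 1], ![0, 0, 0, 0]]

theorem labelVec_surjective : Function.Surjective labelVec := by
  unfold Function.Surjective
  decide +kernel

/-- The map `f` on labels describes the action of `a` on vectors. -/
def Tracks (f : Fin 16 → Fin 16) (a : AGL 4 (ZMod 2)) : Prop :=
  ∀ k, affineAct a (labelVec k) = labelVec (f k)

namespace Tracks

variable {f g : Fin 16 → Fin 16} {a b : AGL 4 (ZMod 2)}

theorem mul (ha : Tracks f a) (hb : Tracks g b) : Tracks (f ∘ g) (a * b) := fun k => by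
  rw [affineAct_mul, hb, ha]
  rfl

theorem pow (ha : Tracks f a) : ∀ m : ℕ, Tracks f^[m] (a ^ m)
  | 0 => fun k => by simp [affineAct_one]
  | m + 1 => by
    rw [pow_succ, Function.iterate_succ]
    exact (ha.pow m).mul ha

theorem eq_of_forall (ha : Tracks f a) (h : ∀ k, affineAct b (labelVec k) = labelVec (f k)) :
    a = b := by
  refine affineAct_injective fun v => ?_
  obtain ⟨k, rfl⟩ := labelVec_surjective v
  rw [ha, h]

end Tracks

/-- The action on labels of `pairWord a b w`, where `f` and `g` describe `a` and `b`. -/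
def pairWordFun (f g : Fin 16 → Fin 16) (w : List (ℕ × ℕ)) (k : Fin 16) : Fin 16 :=
  w.foldr (fun p l => f^[p.1] (g^[p.2] l)) k

theorem Tracks.pairWord {f g : Fin 16 → Fin 16} {a b : AGL 4 (ZMod 2)} (ha : Tracks f a)
    (hb : Tracks g b) : ∀ w, Tracks (pairWordFun f g w) (pairWord a b w)
  | [] => fun k => affineAct_one _
  | p :: w => by
    have := ((ha.pow p.1).mul (hb.pow p.2)).mul (ha.pairWord hb w)
    rw [_root_.pairWord, List.map_cons, List.prod_cons]
    exact this

/-! ### The generators -/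

/-- The Singer cycle `v ↦ α v`. -/
def singer : AGL 4 (ZMod 2) :=
  ⟨1, ⟨!![0, 0, 0, 1; 1, 0, 0, 1; 0, 1, 0, 0; 0, 0, 1, 0],
    !![1, 1, 0, 0; 0, 0, 1, 0; 0, 0, 0, 1; 1, 0, 0, 0], by decide +kernel, by decide +kernel⟩⟩

def singerFun : Fin 16 → Fin 16 := ![1, 2, 3, 4, 5, 6, 7, 8, 9, 10, 11, 12, 13, 14, 0, 15]

theorem tracks_singer : Tracks singerFun singer := by
  unfold Tracks
  decide +kernel

theorem singer_pow : singer ^ 15 = 1 :=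
  (tracks_singer.pow 15).eq_of_forall fun k => by
    rw [affineAct_one]
    revert k
    decide +kernel

/-- An element of order `15` fixing the vector `α`, whose linear part generates `GL(4, 2)` together
with `singer`. -/
def singer' : AGL 4 (ZMod 2) :=
  ⟨Multiplicative.ofAdd ![1, 0, 0, 0], ⟨!![1, 1, 0, 0; 0, 1, 1, 0; 1, 0, 1, 1; 1, 0, 0, 1],
    !![1, 1, 1, 1; 0, 1, 1, 1; 0, 0, 1, 1; 1, 1, 1, 0], by decide +kernel, by decide +kernel⟩⟩

def singerFun' : Fin 16 → Fin 16 := ![6, 1, 10, 13, 12, 2, 7, 4, 9, 11, 14, 3, 8, 5, 15, 0]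

theorem tracks_singer' : Tracks singerFun' singer' := by
  unfold Tracks
  decide +kernel

/-- An element without fixed points, whose linear part has order `6` and fixes exactly one nonzero
vector. -/
def fpf : AGL 4 (ZMod 2) :=
  ⟨Multiplicative.ofAdd ![0, 0, 0, 1], ⟨!![1, 0, 0, 1; 0, 1, 1, 0; 1, 1, 0, 0; 0, 0, 0, 1],
    !![1, 0, 0, 1; 1, 0, 1, 1; 1, 1, 1, 1; 0, 0, 0, 1], by decide +kernel, by decide +kernel⟩⟩

def fpfFun : Fin 16 → Fin 16 := ![13, 11, 9, 0, 7, 6, 4, 1, 12, 10, 14, 8, 15, 5, 2, 3]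

theorem tracks_fpf : Tracks fpfFun fpf := by
  unfold Tracks
  decide +kernel

/-! ### Generation by the Singer cycle and the fixed-point-free element -/

/-- Words in `singer` and `fpf` for the elementary transvections `1 + E i j`. The diagonal entries
are irrelevant. -/
def transvectionWords : Fin 4 → Fin 4 → List (ℕ × ℕ) :=
  ![![[], [(0, 5), (11, 10), (14, 3)], [(2, 2), (3, 5), (7, 4)], [(4, 1), (3, 5), (5, 11)]],
    ![[(0, 2), (2, 4), (5, 3)], [], [(3, 7), (2, 2), (4, 8)], [(6, 8), (4, 5), (8, 4)]],
    ![[(0, 5), (10, 8), (13, 2)], [(1, 5), (2, 4), (4, 0)], [], [(2, 8), (6, 10), (4, 4)]],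
    ![[(2, 6), (5, 7), (6, 9)], [(11, 7), (9, 11)], [(0, 3), (1, 1), (8, 8)], []]]

theorem inl_mem_closure (v : Multiplicative (Fin 4 → ZMod 2)) :
    SemidirectProduct.inl v ∈ closure {singer, fpf} := by
  obtain ⟨k, hk⟩ := labelVec_surjective v.toAdd
  obtain rfl : v = Multiplicative.ofAdd (labelVec k) := by rw [hk, ofAdd_toAdd]
  by_cases h15 : k = 15
  · subst h15
    have : Multiplicative.ofAdd (labelVec 15) = 1 := by decide +kernel
    rw [this, map_one]
    exact one_mem _
  -- `fpf ^ 6` is the translation by `α ^ 4`, so conjugating it by `singer ^ (k + 11)`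
  -- gives the translation by `α ^ (k + 15) = α ^ k`. Modulo `15`, `4 + 14 * k` is `-(k + 11)`.
  have key : singer ^ (k.val + 11) * fpf ^ 6 * singer ^ (4 + 14 * k.val) =
      SemidirectProduct.inl (Multiplicative.ofAdd (labelVec k)) := by
    refine (((tracks_singer.pow _).mul (tracks_fpf.pow 6)).mul
      (tracks_singer.pow _)).eq_of_forall fun l => ?_
    have h1 : ∀ k : Fin 16, k ≠ 15 → ∀ l, labelVec l + labelVec k =
        labelVec (((singerFun^[k.val + 11] ∘ fpfFun^[6]) ∘ singerFun^[4 + 14 * k.val]) l) := by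
      decide +kernel
    rw [← h1 k h15 l]
    simp [affineAct]
  rw [← key]
  exact mul_mem (mul_mem (pow_mem (left_mem_closure_pair _ _) _)
    (pow_mem (right_mem_closure_pair _ _) _)) (pow_mem (left_mem_closure_pair _ _) _)

theorem transvection_mem_closure {i j : Fin 4} (hij : i ≠ j) (g : GL (Fin 4) (ZMod 2))
    (hg : (g : Matrix (Fin 4) (Fin 4) (ZMod 2)) = Matrix.transvection i j 1) :
    SemidirectProduct.inr g ∈ closure {singer, fpf} := by
  have h : ∀ i j : Fin 4, i ≠ j → ∀ k,
      (Matrix.transvection i j (1 : ZMod 2)).mulVec (labelVec k) =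
        labelVec (pairWordFun singerFun fpfFun (transvectionWords i j) k) := by
    decide +kernel
  have key : pairWord singer fpf (transvectionWords i j) = SemidirectProduct.inr g := by
    refine (tracks_singer.pairWord tracks_fpf _).eq_of_forall fun k => ?_
    rw [← h i j hij k, ← hg]
    simp [affineAct]
  rw [← key]
  exact pairWord_mem (left_mem_closure_pair _ _) (right_mem_closure_pair _ _) _

theorem inr_mem_closure (g : GL (Fin 4) (ZMod 2)) :
    SemidirectProduct.inr g ∈ closure {singer, fpf} := by
  suffices h : ∃ g' : GL (Fin 4) (ZMod 2), (g' : Matrix (Fin 4) (Fin 4) (ZMod 2)) = g ∧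
      SemidirectProduct.inr g' ∈ closure {singer, fpf} by
    obtain ⟨g', hg', hmem⟩ := h
    rwa [Units.ext hg'] at hmem
  refine Matrix.diagonal_transvection_induction_of_det_ne_zero
    (fun M => ∃ g' : GL (Fin 4) (ZMod 2), (g' : Matrix (Fin 4) (Fin 4) (ZMod 2)) = M ∧
      SemidirectProduct.inr g' ∈ closure {singer, fpf}) _
    ((Matrix.isUnit_iff_isUnit_det _).mp g.isUnit).ne_zero ?_ ?_ ?_
  · intro D hD
    -- Over `𝔽₂` the only invertible diagonal matrix is the identity.
    have hD1 : D = 1 := by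
      funext i
      rw [Matrix.det_diagonal, Finset.prod_ne_zero_iff] at hD
      exact Fin.eq_one_of_ne_zero _ (hD i (Finset.mem_univ i))
    exact ⟨1, by rw [hD1, Units.val_one]; exact Matrix.diagonal_one.symm, by
      rw [map_one]; exact one_mem _⟩
  · rintro ⟨i, j, hij, c⟩
    obtain rfl | rfl : c = 0 ∨ c = 1 := by
      revert c
      decide
    · exact ⟨1, by simp [Matrix.TransvectionStruct.toMatrix], by rw [map_one]; exact one_mem _⟩
    · have hu : IsUnit (Matrix.transvection i j (1 : ZMod 2)) := by
        rw [Matrix.isUnit_iff_isUnit_det, Matrix.det_transvection_of_ne _ _ hij]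
        exact isUnit_one
      exact ⟨hu.unit, rfl, transvection_mem_closure hij _ rfl⟩
  · rintro A B - - ⟨a, rfl, ha⟩ ⟨b, rfl, hb⟩
    exact ⟨a * b, rfl, by rw [map_mul]; exact mul_mem ha hb⟩

theorem closure_singer_fpf_eq_top : closure {singer, fpf} = ⊤ := by
  refine eq_top_iff.mpr fun a _ => ?_
  rw [← SemidirectProduct.inl_left_mul_inr_right a]
  exact mul_mem (inl_mem_closure _) (inr_mem_closure _)

theorem closure_singer_singer'_eq_top : closure {singer, singer'} = ⊤ := by
  have key : pairWord singer singer' [(2, 5), (4, 9), (6, 14)] = fpf :=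
    (tracks_singer.pairWord tracks_singer' _).eq_of_forall fun k => by
      rw [tracks_fpf]
      revert k
      decide +kernel
  exact closure_pair_eq_top_of_mem closure_singer_fpf_eq_top (left_mem_closure_pair _ _)
    (key ▸ pairWord_mem (left_mem_closure_pair _ _) (right_mem_closure_pair _ _) _)

/-! ### Generation by the remaining pairs -/

/-- A criterion for `a` and the `i`-th `singer`-conjugate of `b` to generate: `a` and `singer`
generate, and `singer` is a word in the two elements. The criterion is in terms of the actions `f`
and `g` of `a` and `b` on labels. -/
theorem closure_conj_singer_eq_top {f g : Fin 16 → Fin 16} {a b : AGL 4 (ZMod 2)}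
    (ha : Tracks f a) (hb : Tracks g b) (htop : closure {singer, a} = ⊤) (i : Fin 15)
    (w : List (ℕ × ℕ))
    (hw : ∀ k, pairWordFun f (singerFun^[i.val] ∘ g ∘ singerFun^[15 - i.val]) w k = singerFun k) :
    closure {a, singer ^ i.val * b * (singer ^ i.val)⁻¹} = ⊤ := by
  have hinv : (singer ^ i.val)⁻¹ = singer ^ (15 - i.val) := by
    rw [inv_eq_iff_mul_eq_one, ← pow_add, Nat.add_sub_cancel' i.isLt.le, singer_pow]
  have hconj := ((tracks_singer.pow i.val).mul hb).mul (tracks_singer.pow (15 - i.val))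
  rw [hinv]
  have key : pairWord a (singer ^ i.val * b * singer ^ (15 - i.val)) w = singer :=
    (ha.pairWord hconj w).eq_of_forall fun k => by
      rw [tracks_singer]
      exact congrArg labelVec (hw k).symm
  have hmem := pairWord_mem (left_mem_closure_pair a (singer ^ i.val * b * singer ^ (15 - i.val)))
    (right_mem_closure_pair _ _) w
  rw [key] at hmem
  exact closure_pair_eq_top_of_mem htop hmem (left_mem_closure_pair _ _)

/-- The `i`-th entry is a word for `singer` in `singer'` and its `i`-th conjugate. The entry for
`i = 0` is irrelevant. -/
def singerSingerWords : Fin 15 → List (ℕ × ℕ) :=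
  ![[], [(2, 2), (4, 3), (9, 3)], [(8, 5), (8, 1)], [(1, 1), (4, 9), (10, 12)],
    [(2, 7), (11, 10), (11, 9)], [(1, 11), (9, 5), (1, 3)], [(0, 10), (10, 12), (11, 14)],
    [(0, 4), (11, 4), (13, 2)], [(0, 2), (9, 7), (7, 7)], [(1, 14), (8, 6), (14, 14)],
    [(1, 2), (8, 11), (3, 10)], [(0, 12), (7, 7), (9, 12)], [(0, 2), (7, 14), (6, 6)],
    [(0, 8), (5, 8), (1, 0)], [(0, 1), (2, 9), (2, 9), (7, 10)]]

/-- The `i`-th entry is a word for `singer` in `singer'` and the `i`-th conjugate of `fpf`. -/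
def singerFpfWords : Fin 15 → List (ℕ × ℕ) :=
  ![[(2, 2), (1, 3), (8, 8), (4, 0)], [(1, 5), (7, 2), (8, 3)], [(1, 9), (10, 6)],
    [(2, 4), (7, 3)], [(1, 2), (10, 5), (7, 11)], [(0, 3), (6, 5), (13, 0)],
    [(0, 4), (7, 4), (6, 5)], [(0, 1), (12, 8), (1, 8)], [(0, 5), (7, 4), (9, 0)],
    [(0, 1), (14, 1), (10, 10)], [(0, 3), (14, 4), (12, 0)], [(1, 4), (12, 5), (12, 10)],
    [(5, 11), (11, 5), (7, 9)], [(0, 1), (1, 4), (6, 5)], [(5, 1), (1, 3), (9, 9)]]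

/-- The `i`-th entry is a word for `singer` in `fpf` and its `i`-th conjugate. The entry for `i = 0`
is irrelevant. -/
def fpfFpfWords : Fin 15 → List (ℕ × ℕ) :=
  ![[], [(1, 1), (3, 7), (4, 3)], [(0, 1), (3, 4), (10, 2)], [(1, 4), (5, 11), (4, 9)],
    [(0, 1), (1, 1), (10, 8), (7, 0)], [(4, 5), (3, 4), (7, 11)], [(5, 5), (1, 2)],
    [(10, 1), (1, 3), (10, 5)], [(0, 1), (3, 10), (2, 11), (7, 9)], [(0, 5), (5, 1), (2, 0)],
    [(0, 1), (2, 2), (5, 5), (7, 5)], [(1, 1), (1, 10), (8, 7)],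
    [(0, 1), (4, 5), (11, 4), (9, 0)], [(3, 7), (11, 6)], [(0, 1), (1, 3), (7, 4), (3, 0)]]

theorem closure_singer'_conj_singer' (i : Fin 15) (hi : i ≠ 0) :
    closure {singer', singer ^ i.val * singer' * (singer ^ i.val)⁻¹} = ⊤ := by
  refine closure_conj_singer_eq_top tracks_singer' tracks_singer' closure_singer_singer'_eq_top i
    (singerSingerWords i) ?_
  revert i
  decide +kernel

theorem closure_singer'_conj_fpf (i : Fin 15) :
    closure {singer', singer ^ i.val * fpf * (singer ^ i.val)⁻¹} = ⊤ := by
  refine closure_conj_singer_eq_top tracks_singer' tracks_fpf closure_singer_singer'_eq_top i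
    (singerFpfWords i) ?_
  revert i
  decide +kernel

theorem closure_fpf_conj_fpf (i : Fin 15) (hi : i ≠ 0) :
    closure {fpf, singer ^ i.val * fpf * (singer ^ i.val)⁻¹} = ⊤ := by
  refine closure_conj_singer_eq_top tracks_fpf tracks_fpf closure_singer_fpf_eq_top i
    (fpfFpfWords i) ?_
  revert i
  decide +kernel

/-! ### The pairwise generating family -/

/-- The family of `31` elements: `singer`, and the conjugates of `singer'` and `fpf` by the powers
of `singer`. -/
def generatingFamily : Option (Fin 15 ⊕ Fin 15) → AGL 4 (ZMod 2)
  | none => singer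
  | some (.inl i) => singer ^ i.val * singer' * (singer ^ i.val)⁻¹
  | some (.inr i) => singer ^ i.val * fpf * (singer ^ i.val)⁻¹

theorem closure_singer_conj {a : AGL 4 (ZMod 2)} (h : closure {singer, a} = ⊤) (i : ℕ) :
    closure {singer, singer ^ i * a * (singer ^ i)⁻¹} = ⊤ := by
  have := closure_pair_conj (singer ^ i) _ _ h
  rwa [← pow_succ, pow_succ', mul_inv_cancel_right] at this

theorem pairwise_generatingFamily :
    Pairwise fun i j => closure {generatingFamily i, generatingFamily j} = ⊤ := by
  rintro (_ | i | i) (_ | j | j) hij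
  · exact absurd rfl hij
  · exact closure_singer_conj closure_singer_singer'_eq_top _
  · exact closure_singer_conj closure_singer_fpf_eq_top _
  · rw [Set.pair_comm]
    exact closure_singer_conj closure_singer_singer'_eq_top _
  · exact closure_pair_conj_eq_top singer_pow
      (closure_singer'_conj_singer' _ (sub_ne_zero.mpr (by rintro rfl; exact hij rfl)))
  · exact closure_pair_conj_eq_top singer_pow (closure_singer'_conj_fpf _)
  · rw [Set.pair_comm]
    exact closure_singer_conj closure_singer_fpf_eq_top _
  · rw [Set.pair_comm]
    exact closure_pair_conj_eq_top singer_pow (closure_singer'_conj_fpf _)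
  · exact closure_pair_conj_eq_top singer_pow
      (closure_fpf_conj_fpf _ (sub_ne_zero.mpr (by rintro rfl; exact hij rfl)))

theorem mainTheorem8 : 31 ≤ groupSum (AGL 4 (ZMod 2)) := by
  simpa using card_le_groupSum generatingFamily pairwise_generatingFamily
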